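/- Let $X$ be a complex Banach space and let $(T(t))_{t\ge 0}$ be an analytic $C_0$-semigroup on $X$ with generator $A$; that is, for some $\delta\in(0,\pi/2]$ the semigroup extends to a family of bounded operators $T(z)$, $z\in\Sigma_\delta\cup\{0\}$, $\Sigma_\delta=\{z\in\mathbb{C}\setminus\{0\}:|\arg z|<\delta\}$, which satisfies $T(z+w)=T(z)T(w)$ for $z,w\in\Sigma_\delta$, is holomorphic on $\Sigma_\delta$, and satisfies $T(z)x\to x$ as $z\to 0$ in $\Sigma_{\delta'}$ for all $x\in X$ and $0<\delta'<\delta$ (no boundedness on the sector is assumed). Suppose that $1\in\rho(A)$ and let $V=(A+I)(A-I)^{-1}$ be the cogenerator of $T(\cdot)$. If there are real constants $C,k\ge 0$ such that $\|V^n\|\le C\,n^k$ for every integer $n\ge 1$, then there is a constant $M$ such that $$\|T(t)\|\le M\,(1+t^{2k+1})\qquad\text{for every } t\ge 0.$$ -/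

import Mathlib

open Filter Topology
open scoped NNReal

/-- A `C₀`-semigroup (strongly continuous one-parameter semigroup) of bounded linear operators on
a complex normed space `X`. -/
structure C0Semigroup (X : Type*) [NormedAddCommGroup X] [NormedSpace ℂ X] where
  toFun : ℝ≥0 → X →L[ℂ] X
  map_zero' : toFun 0 = ContinuousLinearMap.id ℂ X
  map_add' : ∀ s t : ℝ≥0, toFun (s + t) = (toFun s).comp (toFun t)
  continuous_orbit' : ∀ x : X, Continuous fun t : ℝ≥0 => toFun t x

namespace C0Semigroup

instance {X : Type*} [NormedAddCommGroup X] [NormedSpace ℂ X] :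
    CoeFun (C0Semigroup X) fun _ => ℝ≥0 → X →L[ℂ] X :=
  ⟨C0Semigroup.toFun⟩

/-- `T.HasGenerator x y` says that the limit of `(T t x - x) / t` as `t ↓ 0` exists and is `y`,
that is, `x` is in the domain of the generator `A` and `A x = y`. -/
def HasGenerator {X : Type*} [NormedAddCommGroup X] [NormedSpace ℂ X]
    (T : C0Semigroup X) (x y : X) : Prop :=
  Tendsto (fun t : ℝ≥0 => ((t : ℝ) : ℂ)⁻¹ • (T t x - x)) (𝓝[>] 0) (𝓝 y)

theorem HasGenerator.unique {X : Type*} [NormedAddCommGroup X] [NormedSpace ℂ X]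
    {T : C0Semigroup X} {x y z : X} (h : T.HasGenerator x y) (h' : T.HasGenerator x z) : y = z :=
  tendsto_nhds_unique h h'

theorem HasGenerator.add {X : Type*} [NormedAddCommGroup X] [NormedSpace ℂ X]
    {T : C0Semigroup X} {x y x' y' : X} (h : T.HasGenerator x y) (h' : T.HasGenerator x' y') :
    T.HasGenerator (x + x') (y + y') := by
  refine (Tendsto.add h h').congr fun t => ?_
  rw [← smul_add, map_add]
  congr 1
  abel

theorem HasGenerator.smul {X : Type*} [NormedAddCommGroup X] [NormedSpace ℂ X]
    {T : C0Semigroup X} {x y : X} (c : ℂ) (h : T.HasGenerator x y) :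
    T.HasGenerator (c • x) (c • y) := by
  refine (Tendsto.const_smul h c).congr fun t => ?_
  rw [map_smul, ← smul_sub, smul_comm]

/-- The generator `A` of a `C₀`-semigroup, as an unbounded operator: its domain is the set of all
`x` for which the limit of `(T t x - x) / t` as `t ↓ 0` exists, and `A x` is that limit. -/
noncomputable def generator {X : Type*} [NormedAddCommGroup X] [NormedSpace ℂ X]
    (T : C0Semigroup X) : X →ₗ.[ℂ] X where
  domain :=
    { carrier := {x | ∃ y, T.HasGenerator x y}
      add_mem' := fun ⟨_, h⟩ ⟨_, h'⟩ => ⟨_, h.add h'⟩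
      zero_mem' := ⟨0, by simp [HasGenerator]⟩
      smul_mem' := fun c _ ⟨_, h⟩ => ⟨_, h.smul c⟩ }
  toFun :=
    { toFun := fun x => Classical.choose x.2
      map_add' := fun x x' => (Classical.choose_spec (x + x').2).unique
        ((Classical.choose_spec x.2).add (Classical.choose_spec x'.2))
      map_smul' := fun c x => (Classical.choose_spec (c • x).2).unique
        ((Classical.choose_spec x.2).smul c) }

theorem mem_generator_domain {X : Type*} [NormedAddCommGroup X] [NormedSpace ℂ X]
    {T : C0Semigroup X} {x : X} : x ∈ T.generator.domain ↔ ∃ y, T.HasGenerator x y :=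
  Iff.rfl

theorem hasGenerator_generator {X : Type*} [NormedAddCommGroup X] [NormedSpace ℂ X]
    (T : C0Semigroup X) (x : T.generator.domain) : T.HasGenerator x (T.generator x) :=
  Classical.choose_spec x.2

end C0Semigroup

/-- `IsShiftInverse A c J` says that the bounded operator `J` is the two-sided inverse of
`A - c I : D(A) → X`; the existence of such a `J` is the statement that `c ∈ ρ(A)`. -/
def IsShiftInverse {X : Type*} [NormedAddCommGroup X] [NormedSpace ℂ X]
    (A : X →ₗ.[ℂ] X) (c : ℂ) (J : X →L[ℂ] X) : Prop :=
  (∀ x : X, ∃ h : J x ∈ A.domain, A ⟨J x, h⟩ - c • J x = x) ∧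
    ∀ x : A.domain, J (A x - c • (x : X)) = x

/-- `T.IsCogenerator V` says that `1 ∈ ρ(A)`, where `A` is the generator of `T`, and that
`V = (A + I)(A - I)⁻¹`. -/
def C0Semigroup.IsCogenerator {X : Type*} [NormedAddCommGroup X] [NormedSpace ℂ X]
    (T : C0Semigroup X) (V : X →L[ℂ] X) : Prop :=
  ∃ J : X →L[ℂ] X, IsShiftInverse T.generator 1 J ∧
    ∀ x : X, ∃ h : J x ∈ T.generator.domain, V x = T.generator ⟨J x, h⟩ + J x

/-- The open sector `{z ≠ 0 : |arg z| < δ}`. -/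
def openSector (δ : ℝ) : Set ℂ :=
  {z | z ≠ 0 ∧ |z.arg| < δ}

/-- A `C₀`-semigroup is analytic if, for some angle `δ ∈ (0, π/2]`, it extends to a family `S` of
bounded operators on the sector of angle `δ` together with `0`, which satisfies the semigroup law,
is holomorphic in the sector, and is strongly continuous at `0` in every smaller sector. No
boundedness on the sector is required. (Values of `S` elsewhere are irrelevant.) -/
def C0Semigroup.IsAnalytic {X : Type*} [NormedAddCommGroup X] [NormedSpace ℂ X]
    (T : C0Semigroup X) : Prop :=
  ∃ δ : ℝ, 0 < δ ∧ δ ≤ Real.pi / 2 ∧ ∃ S : ℂ → X →L[ℂ] X,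
    (∀ t : ℝ≥0, S ((t : ℝ) : ℂ) = T t) ∧
    (∀ z ∈ openSector δ, ∀ w ∈ openSector δ, S (z + w) = (S z).comp (S w)) ∧
    DifferentiableOn ℂ S (openSector δ) ∧
    ∀ δ' : ℝ, 0 < δ' → δ' < δ → ∀ x : X,
      Tendsto (fun z => S z x) (𝓝[openSector δ'] 0) (𝓝 x)

/-! With `J = (A - I)⁻¹`, `V = 1 + 2J` and formally `T(t) = exp(-t(1+V)/(1-V))`. The Taylor
coefficients of this exponential decay too slowly for a power series in `V`. Multiplied by `(1-v)^m`
with `m` large they decay fast: differentiating in `v` gives a recurrence (`succ_mul_cayleyCoeff`)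
that trades two factors `1-v` for a gain of order `(t+1)/(t+1+n)`. It starts from coefficients
bounded by 1 (`sum_cayleyCoeff_sq_le_one`). Summed against `‖V^n‖`, this makes the series `F(t)` of
`exp(-t(1+V)/(1-V))(1-V)^(m+1)` have norm `O((t+1)^(k+1))` (`exists_cayleySum_spec`).

An ODE argument identifies `F(t)J` with `(1-V)^(m+1) T(t)J`, a multiple of `T(t)J^(m+2)`.
Analyticity removes the smoothing factor: `T(1) = J^(m+2) B` with `B` bounded, so `T(t+1) =
T(t)J^(m+2)B` is `O((t+1)^(k+1))`, and `k+1 ≤ 2k+1`. -/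

/-! ### Taylor coefficients and their differential equation in `t`. -/

/-- The polynomials `q n` with `exp (-2 t v / (1 - v)) = ∑ q n t * v ^ n`. -/
noncomputable def laguerrePoly : ℕ → ℝ → ℝ
  | 0 => fun _ => 1
  | n + 1 => fun t => laguerrePoly n t - laguerrePoly n 0 - 2 * ∫ s in (0 : ℝ)..t, laguerrePoly n s

/-- The Taylor coefficients of `v ↦ exp (-t (1 + v) / (1 - v)) * (1 - v) ^ m`. -/
noncomputable def cayleyCoeff : ℕ → ℕ → ℝ → ℝ
  | 0, n => fun t => Real.exp (-t) * laguerrePoly n t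
  | m + 1, 0 => cayleyCoeff m 0
  | m + 1, n + 1 => fun t => cayleyCoeff m (n + 1) t - cayleyCoeff m n t

/-- The derivative of `cayleyCoeff` with respect to the last argument. -/
noncomputable def cayleyCoeffDeriv : ℕ → ℕ → ℝ → ℝ
  | 0, n => fun t => -((∑ i ∈ Finset.range (n + 1), cayleyCoeff 0 i t) +
      ∑ i ∈ Finset.range n, cayleyCoeff 0 i t)
  | m + 1, 0 => cayleyCoeffDeriv m 0
  | m + 1, n + 1 => fun t => cayleyCoeffDeriv m (n + 1) t - cayleyCoeffDeriv m n t

theorem hasDerivAt_laguerrePoly (n : ℕ) (t : ℝ) :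
    HasDerivAt (laguerrePoly n) (-2 * ∑ i ∈ Finset.range n, laguerrePoly i t) t := by
  induction n generalizing t with
  | zero => simpa [laguerrePoly] using hasDerivAt_const t (1 : ℝ)
  | succ n ih =>
    have hc : Continuous (laguerrePoly n) :=
      continuous_iff_continuousAt.2 fun s => (ih s).continuousAt
    have h := ((ih t).sub_const (laguerrePoly n 0)).sub
      ((hc.integral_hasStrictDerivAt 0 t).hasDerivAt.const_mul 2)
    refine h.congr_deriv ?_
    rw [Finset.sum_range_succ]
    ring

theorem laguerrePoly_succ_zero (n : ℕ) : laguerrePoly (n + 1) 0 = 0 := by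
  simp [laguerrePoly]

theorem cayleyCoeff_col_zero (m : ℕ) (t : ℝ) : cayleyCoeff m 0 t = Real.exp (-t) := by
  induction m with
  | zero => simp [cayleyCoeff, laguerrePoly]
  | succ m ih => simpa [cayleyCoeff] using ih

theorem cayleyCoeff_zero_succ (n : ℕ) : cayleyCoeff 0 (n + 1) 0 = 0 := by
  simp [cayleyCoeff, laguerrePoly_succ_zero]

theorem cayleyCoeff_succ_succ (m n : ℕ) (t : ℝ) :
    cayleyCoeff (m + 1) (n + 1) t = cayleyCoeff m (n + 1) t - cayleyCoeff m n t := by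
  rw [cayleyCoeff]

theorem cayleyCoeffDeriv_succ_succ (m n : ℕ) (t : ℝ) :
    cayleyCoeffDeriv (m + 1) (n + 1) t =
      cayleyCoeffDeriv m (n + 1) t - cayleyCoeffDeriv m n t := by
  rw [cayleyCoeffDeriv]

theorem hasDerivAt_cayleyCoeff (m n : ℕ) (t : ℝ) :
    HasDerivAt (cayleyCoeff m n) (cayleyCoeffDeriv m n t) t := by
  induction m generalizing n with
  | zero =>
    have h := ((hasDerivAt_neg t).exp).mul (hasDerivAt_laguerrePoly n t)
    refine (h.congr_deriv ?_ : HasDerivAt (fun t => Real.exp (-t) * laguerrePoly n t) _ t)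
    simp only [cayleyCoeffDeriv, cayleyCoeff, ← Finset.mul_sum, Finset.sum_range_succ]
    ring
  | succ m ih =>
    cases n with
    | zero => exact ih 0
    | succ n => exact (ih (n + 1)).sub (ih n)

theorem cayleyCoeffDeriv_col_zero (m : ℕ) (t : ℝ) :
    cayleyCoeffDeriv m 0 t = -cayleyCoeff m 0 t := by
  induction m with
  | zero => simp [cayleyCoeffDeriv]
  | succ m ih => simpa [cayleyCoeffDeriv, cayleyCoeff] using ih

/-- Coefficients of `(1-v) ∂ₜF = -(1+v) F`. A derivative at level `m+1` is thus controlled by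
coefficients at level `m`. -/
theorem cayleyCoeffDeriv_sub (m n : ℕ) (t : ℝ) :
    cayleyCoeffDeriv m (n + 1) t - cayleyCoeffDeriv m n t =
      -(cayleyCoeff m (n + 1) t + cayleyCoeff m n t) := by
  have h0 : ∀ n, cayleyCoeffDeriv 0 (n + 1) t - cayleyCoeffDeriv 0 n t =
      -(cayleyCoeff 0 (n + 1) t + cayleyCoeff 0 n t) := fun n => by
    simp only [cayleyCoeffDeriv, Finset.sum_range_succ]
    ring
  induction m generalizing n with
  | zero => exact h0 n
  | succ m ih =>
    cases n with
    | zero =>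
      rw [cayleyCoeffDeriv_succ_succ, cayleyCoeff_succ_succ, ih, cayleyCoeffDeriv_col_zero,
        cayleyCoeff_col_zero, cayleyCoeff_col_zero]
      ring
    | succ n =>
      rw [cayleyCoeffDeriv_succ_succ, cayleyCoeffDeriv_succ_succ, cayleyCoeff_succ_succ,
        cayleyCoeff_succ_succ, ih, ih]
      ring

/-! ### Bounds on the coefficients, uniform in `n` and `t`. -/

/-- `d/dt ∑_{n ≤ N} aₙ² = -2 (∑_{n ≤ N} aₙ)²`. -/
theorem sum_cayleyCoeff_mul_deriv (N : ℕ) (t : ℝ) :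
    ∑ n ∈ Finset.range N, 2 * cayleyCoeff 0 n t * cayleyCoeffDeriv 0 n t =
      -2 * (∑ n ∈ Finset.range N, cayleyCoeff 0 n t) ^ 2 := by
  induction N with
  | zero => simp
  | succ N ih =>
    rw [Finset.sum_range_succ, ih]
    simp only [cayleyCoeffDeriv, Finset.sum_range_succ]
    ring

/-- The sum is nonincreasing in `t` and is at most 1 at `t = 0`, where only the term `n = 0`
survives. -/
theorem sum_cayleyCoeff_sq_le_one (N : ℕ) {t : ℝ} (ht : 0 ≤ t) :
    ∑ n ∈ Finset.range N, cayleyCoeff 0 n t ^ 2 ≤ 1 := by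
  have hd : ∀ s, HasDerivAt (fun s => ∑ n ∈ Finset.range N, cayleyCoeff 0 n s ^ 2)
      (-2 * (∑ n ∈ Finset.range N, cayleyCoeff 0 n s) ^ 2) s := fun s => by
    rw [← sum_cayleyCoeff_mul_deriv]
    refine (HasDerivAt.fun_sum fun n _ => (hasDerivAt_cayleyCoeff 0 n s).pow 2).congr_deriv ?_
    simp
  have hanti : Antitone fun s => ∑ n ∈ Finset.range N, cayleyCoeff 0 n s ^ 2 :=
    antitone_of_deriv_nonpos (fun s => (hd s).differentiableAt) fun s => by
      rw [(hd s).deriv]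
      nlinarith [sq_nonneg (∑ n ∈ Finset.range N, cayleyCoeff 0 n s)]
  refine (hanti ht).trans ?_
  cases N with
  | zero => simp
  | succ N =>
    simp [Finset.sum_range_succ', cayleyCoeff_zero_succ, cayleyCoeff_col_zero]

theorem abs_cayleyCoeff_zero_le_one (n : ℕ) {t : ℝ} (ht : 0 ≤ t) : |cayleyCoeff 0 n t| ≤ 1 := by
  rw [← sq_le_one_iff_abs_le_one]
  exact (Finset.single_le_sum (f := fun n => cayleyCoeff 0 n t ^ 2) (fun _ _ => sq_nonneg _)
    (Finset.mem_range.2 n.lt_succ_self)).trans (sum_cayleyCoeff_sq_le_one (n + 1) ht)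

theorem exists_abs_cayleyCoeff_le (m : ℕ) :
    ∃ C, 0 ≤ C ∧ ∀ (n : ℕ) (t : ℝ), 0 ≤ t → |cayleyCoeff m n t| ≤ C := by
  induction m with
  | zero => exact ⟨1, zero_le_one, fun n t ht => abs_cayleyCoeff_zero_le_one n ht⟩
  | succ m ih =>
    obtain ⟨C, hC, h⟩ := ih
    refine ⟨C + C, by positivity, fun n t ht => ?_⟩
    cases n with
    | zero => exact (h 0 t ht).trans (by linarith)
    | succ n =>
      rw [cayleyCoeff_succ_succ]
      exact (abs_sub _ _).trans (add_le_add (h _ t ht) (h _ t ht))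

/-- Coefficient of `v^n` in `∂ᵥF₂ = -2t F₀ - 2F₁`, where `Fₘ = exp(-t(1+v)/(1-v))(1-v)^m`. By
induction, the left side `u` for `n+1` solves `u' = -u` with `u(0) = 0`. -/
theorem succ_mul_cayleyCoeff_two (n : ℕ) (t : ℝ) :
    (n + 1) * cayleyCoeff 2 (n + 1) t + 2 * t * cayleyCoeff 0 n t + 2 * cayleyCoeff 1 n t = 0 := by
  induction n generalizing t with
  | zero =>
    rw [cayleyCoeff_succ_succ, cayleyCoeff_succ_succ]
    simp only [cayleyCoeff, laguerrePoly]
    simp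
    ring
  | succ n ih =>
    set u : ℕ → ℝ → ℝ := fun n t =>
      (n + 1) * cayleyCoeff 2 (n + 1) t + 2 * t * cayleyCoeff 0 n t + 2 * cayleyCoeff 1 n t with hu
    set d : ℕ → ℝ → ℝ := fun n t => (n + 1) * cayleyCoeffDeriv 2 (n + 1) t +
      (2 * cayleyCoeff 0 n t + 2 * t * cayleyCoeffDeriv 0 n t) + 2 * cayleyCoeffDeriv 1 n t with hd
    have hud : ∀ n t, HasDerivAt (u n) (d n t) t := fun n t => by
      refine ((((hasDerivAt_cayleyCoeff 2 (n + 1) t).const_mul ((n : ℝ) + 1)).add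
        (((hasDerivAt_id t).const_mul 2).mul (hasDerivAt_cayleyCoeff 0 n t))).add
        ((hasDerivAt_cayleyCoeff 1 n t).const_mul 2)).congr_deriv ?_
      simp [hd]
    have hu0 : ∀ t, u n t = 0 := ih
    have hd0 : ∀ t, d n t = 0 := fun t => by
      have h1 := hud n t
      rw [show u n = fun _ => 0 from funext hu0] at h1
      exact h1.unique (hasDerivAt_const t 0)
    have hds : ∀ t, d (n + 1) t = -u (n + 1) t := fun t => by
      have e0 := cayleyCoeffDeriv_sub 0 n t
      have e1 := cayleyCoeffDeriv_sub 1 n t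
      have e2 := cayleyCoeffDeriv_sub 2 (n + 1) t
      have e3 := cayleyCoeffDeriv_sub 1 (n + 1) t
      have e4 := cayleyCoeffDeriv_succ_succ 1 (n + 1) t
      have e5 := cayleyCoeff_succ_succ 1 (n + 1) t
      have e6 := cayleyCoeff_succ_succ 0 n t
      have h1 := hu0 t
      have h2 := hd0 t
      simp only [hu, hd] at h1 h2 ⊢
      push_cast
      norm_num at e4 e5 e6
      linear_combination h2 - h1 + (n + 1 : ℝ) * e2 + 2 * t * e0 + 2 * e1 + e3 + e4 + e5 - 2 * e6
    have hcon : ∀ s, HasDerivAt (fun s => Real.exp s * u (n + 1) s) 0 s := fun s => by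
      refine ((Real.hasDerivAt_exp s).mul (hud (n + 1) s)).congr_deriv ?_
      rw [hds]
      ring
    have h0 : u (n + 1) 0 = 0 := by
      simp only [hu, cayleyCoeff_succ_succ, cayleyCoeff_zero_succ]
      cases n with
      | zero => norm_num
      | succ n => simp [cayleyCoeff_zero_succ]
    have h1 := is_const_of_deriv_eq_zero (fun s => (hcon s).differentiableAt)
      (fun s => (hcon s).deriv) t 0
    simp only [h0, mul_zero, mul_eq_zero, (Real.exp_pos t).ne', false_or] at h1
    exact h1

theorem succ_mul_cayleyCoeff (m n : ℕ) (t : ℝ) :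
    (n + 1) * cayleyCoeff (m + 2) (n + 1) t =
      -(2 * t * cayleyCoeff m n t + (m + 2) * cayleyCoeff (m + 1) n t) := by
  induction m generalizing n with
  | zero =>
    have := succ_mul_cayleyCoeff_two n t
    norm_num
    linarith
  | succ m ih =>
    cases n with
    | zero =>
      have h := ih 0
      rw [cayleyCoeff_succ_succ]
      simp only [cayleyCoeff_col_zero] at h ⊢
      push_cast at h ⊢
      linarith
    | succ n =>
      have h1 := ih (n + 1)
      have h2 := ih n
      rw [cayleyCoeff_succ_succ (m + 2) (n + 1), cayleyCoeff_succ_succ m n,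
        cayleyCoeff_succ_succ (m + 1) n]
      have h3 := cayleyCoeff_succ_succ (m + 1) n t
      push_cast at h1 h2 ⊢
      linear_combination h1 - h2 + (n + 1 : ℝ) * h3

theorem exists_pow_mul_abs_cayleyCoeff_le (j m : ℕ) (hm : 2 * j ≤ m) :
    ∃ C, 0 ≤ C ∧ ∀ (n : ℕ) (t : ℝ), 0 ≤ t →
      (t + 1 + n) ^ j * |cayleyCoeff m n t| ≤ C * (t + 1) ^ j := by
  induction j generalizing m with
  | zero => simpa using exists_abs_cayleyCoeff_le m
  | succ j ih =>
    obtain ⟨m, rfl⟩ : ∃ l, m = l + 2 := ⟨m - 2, by omega⟩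
    obtain ⟨C₀, hC₀, h₀⟩ := ih m (by omega)
    obtain ⟨C₁, hC₁, h₁⟩ := ih (m + 1) (by omega)
    obtain ⟨C₂, hC₂, h₂⟩ := ih (m + 2) (by omega)
    refine ⟨C₂ + 2 ^ j * (2 * C₀ + (m + 2) * C₁), by positivity, fun n t ht => ?_⟩
    cases n with
    | zero =>
      have h := h₂ 0 t ht
      have h4 : 0 ≤ 2 ^ j * (2 * C₀ + (m + 2) * C₁) * (t + 1) ^ (j + 1) := by positivity
      have := mul_le_mul_of_nonneg_left h (by positivity : 0 ≤ t + 1)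
      simp only [Nat.cast_zero, add_zero, pow_succ] at this h4 ⊢
      linarith
    | succ n =>
      have hrec : (n + 1) * |cayleyCoeff (m + 2) (n + 1) t| ≤
          (t + 1) * (2 * |cayleyCoeff m n t| + (m + 2) * |cayleyCoeff (m + 1) n t|) := by
        rw [← abs_of_nonneg (by positivity : (0 : ℝ) ≤ n + 1), ← abs_mul, succ_mul_cayleyCoeff,
          abs_neg]
        refine (abs_add_le _ _).trans ?_
        rw [abs_mul (2 * t), abs_mul (m + 2 : ℝ), abs_of_nonneg (by positivity : 0 ≤ 2 * t),
          abs_of_nonneg (by positivity : (0 : ℝ) ≤ m + 2)]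
        nlinarith [abs_nonneg (cayleyCoeff m n t),
          mul_nonneg ht (mul_nonneg (by positivity : (0 : ℝ) ≤ m + 2)
            (abs_nonneg (cayleyCoeff (m + 1) n t)))]
      have hpow : (t + 1 + ((n + 1 : ℕ) : ℝ)) ^ j ≤ 2 ^ j * (t + 1 + n) ^ j := by
        rw [← mul_pow]
        push_cast
        gcongr
        linarith [(Nat.cast_nonneg n : (0 : ℝ) ≤ n)]
      have a₀ := h₀ n t ht
      have a₁ := h₁ n t ht
      have a₂ := h₂ (n + 1) t ht
      set P := (t + 1 + ((n + 1 : ℕ) : ℝ)) ^ j with hP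
      have hP0 : 0 ≤ P := by positivity
      -- Split one factor as `(t+1) + (n+1)`: the first part uses the bound for exponent `j` at
      -- level `m+2`, the second the recurrence.
      calc (t + 1 + ((n + 1 : ℕ) : ℝ)) ^ (j + 1) * |cayleyCoeff (m + 2) (n + 1) t|
          = (t + 1) * (P * |cayleyCoeff (m + 2) (n + 1) t|)
            + P * ((n + 1) * |cayleyCoeff (m + 2) (n + 1) t|) := by
            rw [pow_succ, ← hP]; push_cast; ring
        _ ≤ (t + 1) * (C₂ * (t + 1) ^ j) + 2 ^ j * (t + 1 + n) ^ j *
            ((t + 1) * (2 * |cayleyCoeff m n t| + (m + 2) * |cayleyCoeff (m + 1) n t|)) := by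
            gcongr
        _ = (t + 1) * (C₂ * (t + 1) ^ j) + (t + 1) * 2 ^ j *
            (2 * ((t + 1 + n) ^ j * |cayleyCoeff m n t|) +
              (m + 2) * ((t + 1 + n) ^ j * |cayleyCoeff (m + 1) n t|)) := by ring
        _ ≤ (t + 1) * (C₂ * (t + 1) ^ j) + (t + 1) * 2 ^ j *
            (2 * (C₀ * (t + 1) ^ j) + (m + 2) * (C₁ * (t + 1) ^ j)) := by gcongr
        _ = _ := by ring

theorem sum_one_div_sq_le {τ : ℝ} (hτ : 1 ≤ τ) (N : ℕ) :
    ∑ n ∈ Finset.range N, 1 / (τ + n) ^ 2 ≤ 2 / τ := by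
  have h : ∑ n ∈ Finset.range N, 1 / (τ + n) ^ 2 ≤ 2 / τ - 2 / (τ + N) := by
    induction N with
    | zero => simp
    | succ N ih =>
      have hpos : 0 < τ + N := by positivity
      -- With `x = τ + N ≥ 1`, the right side is `2/(x(x+1))`, and `x+1 ≤ 2x`.
      have : 1 / (τ + N) ^ 2 ≤ 2 / (τ + N) - 2 / (τ + ((N + 1 : ℕ) : ℝ)) := by
        push_cast
        rw [div_sub_div _ _ hpos.ne' (by positivity), div_le_div_iff₀ (by positivity)
          (by positivity)]
        nlinarith [mul_pos hpos hpos, (Nat.cast_nonneg N : (0 : ℝ) ≤ N)]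
      rw [Finset.sum_range_succ]
      linarith
  have : 0 ≤ 2 / (τ + N) := by positivity
  linarith

theorem exists_rpow_mul_abs_cayleyCoeff_le {k : ℝ} (hk : 0 ≤ k) :
    ∃ p : ℕ, ∀ m, p ≤ m → ∃ C, 0 ≤ C ∧ ∀ (n : ℕ) (t : ℝ), 0 ≤ t →
      |cayleyCoeff m n t| * ((n : ℝ) + 1) ^ k ≤
        C * (t + 1) ^ (k + 2) * (1 / (t + 1 + n) ^ 2) := by
  -- `j ≥ k+2` makes the exponent `k+2-j` nonpositive, so `t+1+n` can be replaced by `t+1` there.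
  obtain ⟨j, hj⟩ := exists_nat_ge (k + 2)
  refine ⟨2 * j, fun m hm => ?_⟩
  obtain ⟨C, hC, h⟩ := exists_pow_mul_abs_cayleyCoeff_le j m hm
  refine ⟨C, hC, fun n t ht => ?_⟩
  have hn : (0 : ℝ) ≤ n := n.cast_nonneg
  have hX : 0 < t + 1 + n := by positivity
  have hτ : 0 < t + 1 := by positivity
  rw [mul_one_div, le_div_iff₀ (by positivity)]
  calc |cayleyCoeff m n t| * ((n : ℝ) + 1) ^ k * (t + 1 + n) ^ 2
      ≤ |cayleyCoeff m n t| * (t + 1 + n) ^ k * (t + 1 + n) ^ 2 := by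
        have : ((n : ℝ) + 1) ^ k ≤ (t + 1 + n) ^ k :=
          Real.rpow_le_rpow (by positivity) (by linarith) hk
        gcongr
    _ = ((t + 1 + n) ^ j * |cayleyCoeff m n t|) * (t + 1 + n) ^ (k + 2 - j) := by
        have e : (t + 1 + n) ^ k * (t + 1 + n) ^ 2 =
            (t + 1 + n) ^ j * (t + 1 + n) ^ (k + 2 - j) := by
          rw [← Real.rpow_natCast _ j, ← Real.rpow_add hX, ← Real.rpow_natCast _ 2,
            ← Real.rpow_add hX]
          congr 1
          push_cast
          ring
        linear_combination |cayleyCoeff m n t| * e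
    _ ≤ (C * (t + 1) ^ j) * (t + 1) ^ (k + 2 - j) := by
        refine mul_le_mul (h n t ht) ?_ (by positivity) (by positivity)
        exact Real.rpow_le_rpow_of_nonpos hτ (by linarith) (by linarith)
    _ = C * (t + 1) ^ (k + 2) := by
        rw [mul_assoc, ← Real.rpow_natCast, ← Real.rpow_add hτ]
        congr 2
        ring

/-! ### The power series in `V`. -/

section BanachAlgebra

variable {R : Type*} [NormedRing R] [NormedAlgebra ℝ R]

/-- `ε = -1` and `ε = 1` give the factors `1-V` and `1+V`. -/
theorem HasSum.add_smul_mul_pow {V S : R} {c d : ℕ → ℝ} {ε : ℝ}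
    (h : HasSum (fun n => c n • V ^ n) S) (h0 : d 0 = c 0)
    (h1 : ∀ n, d (n + 1) = c (n + 1) + ε * c n) :
    HasSum (fun n => d n • V ^ n) (S + ε • (S * V)) := by
  have hs := (hasSum_nat_add_iff' 1).2 h
  have hm := (h.mul_right V).const_smul ε
  rw [← hasSum_nat_add_iff' 1]
  convert hs.add hm using 1
  · funext n
    rw [h1, add_smul, smul_mul_assoc, ← pow_succ, smul_smul]
  · simp [h0]
    abel

theorem hasSum_cayleyCoeff_zero (V : R) (m : ℕ) :
    HasSum (fun n => cayleyCoeff m n 0 • V ^ n) ((1 - V) ^ m) := by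
  induction m with
  | zero =>
    convert hasSum_single 0 fun n hn => ?_ using 1
    · simp [cayleyCoeff_col_zero]
    · obtain ⟨n, rfl⟩ := Nat.exists_eq_succ_of_ne_zero hn
      simp [cayleyCoeff_zero_succ]
  | succ m ih =>
    convert ih.add_smul_mul_pow (d := fun n => cayleyCoeff (m + 1) n 0) (ε := -1) rfl
      (fun n => by simp only [cayleyCoeff_succ_succ]; ring) using 1
    rw [pow_succ, mul_sub, mul_one, neg_one_smul, sub_eq_add_neg]

/-- The value of `v ↦ exp (-t (1 + v) / (1 - v)) * (1 - v) ^ m` at `V`. -/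
noncomputable def cayleySum (V : R) (m : ℕ) (t : ℝ) : R :=
  ∑' n, cayleyCoeff m n t • V ^ n

theorem cayleySum_zero (V : R) (m : ℕ) : cayleySum V m 0 = (1 - V) ^ m :=
  (hasSum_cayleyCoeff_zero V m).tsum_eq

variable [CompleteSpace R]

/-- The functional calculus `cayleySum` for elements with polynomially bounded powers. -/
theorem exists_cayleySum_spec {V : R} {K k : ℝ} (hK : 0 ≤ K) (hk : 0 ≤ k)
    (hV : ∀ n : ℕ, ‖V ^ n‖ ≤ K * ((n : ℝ) + 1) ^ k) :
    ∃ (m : ℕ) (M : ℝ), 0 ≤ M ∧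
      (∀ t, 0 ≤ t → ‖cayleySum V (m + 1) t‖ ≤ M * (t + 1) ^ (k + 1)) ∧
      ContinuousOn (cayleySum V (m + 1)) (Set.Ici 0) ∧
      (∀ t, 0 ≤ t → cayleySum V (m + 1) t = cayleySum V m t * (1 - V)) ∧
      ∀ t, 0 < t → HasDerivAt (cayleySum V (m + 1)) (-(cayleySum V m t * (1 + V))) t := by
  obtain ⟨m, hm⟩ := exists_rpow_mul_abs_cayleyCoeff_le hk
  obtain ⟨C₀, hC₀, h₀⟩ := hm m le_rfl
  obtain ⟨C₁, hC₁, h₁⟩ := hm (m + 1) m.le_succ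
  have term : ∀ {C : ℝ} {l : ℕ} (_ : ∀ (n : ℕ) (t : ℝ), 0 ≤ t →
      |cayleyCoeff l n t| * ((n : ℝ) + 1) ^ k ≤ C * (t + 1) ^ (k + 2) * (1 / (t + 1 + n) ^ 2))
      (n : ℕ) (t : ℝ), 0 ≤ t → ‖cayleyCoeff l n t • V ^ n‖ ≤
        K * (C * (t + 1) ^ (k + 2)) * (1 / (t + 1 + n) ^ 2) := fun h n t ht => by
    rw [norm_smul, Real.norm_eq_abs]
    calc _ ≤ |cayleyCoeff _ n t| * (K * ((n : ℝ) + 1) ^ k) := by gcongr; exact hV n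
      _ = K * (|cayleyCoeff _ n t| * ((n : ℝ) + 1) ^ k) := by ring
      _ ≤ K * _ := mul_le_mul_of_nonneg_left (h n t ht) hK
      _ = _ := by ring
  have hsq : ∀ {τ : ℝ}, 1 ≤ τ → Summable fun n : ℕ => 1 / (τ + n) ^ 2 := fun hτ =>
    summable_of_sum_range_le (fun n => by positivity) (sum_one_div_sq_le hτ)
  have hsum : ∀ t, 0 ≤ t → HasSum (fun n => cayleyCoeff m n t • V ^ n) (cayleySum V m t) :=
    fun t ht => (Summable.of_norm_bounded ((hsq (by linarith : 1 ≤ t + 1)).mul_left _)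
      fun n => term h₀ n t ht).hasSum
  have hsucc : ∀ t, 0 ≤ t → HasSum (fun n => cayleyCoeff (m + 1) n t • V ^ n)
      (cayleySum V m t * (1 - V)) := fun t ht => by
    convert (hsum t ht).add_smul_mul_pow (d := fun n => cayleyCoeff (m + 1) n t) (ε := -1) rfl
      (fun n => by simp only [cayleyCoeff_succ_succ]; ring) using 1
    rw [mul_sub, mul_one, neg_one_smul, sub_eq_add_neg]
  have hder : ∀ t, 0 ≤ t → HasSum (fun n => cayleyCoeffDeriv (m + 1) n t • V ^ n)
      (-(cayleySum V m t * (1 + V))) := fun t ht => by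
    have h := ((hsum t ht).add_smul_mul_pow (d := fun n => -cayleyCoeffDeriv (m + 1) n t) (ε := 1)
      (by simp [cayleyCoeffDeriv_col_zero, cayleyCoeff_col_zero])
      (fun n => by rw [cayleyCoeffDeriv_succ_succ, cayleyCoeffDeriv_sub]; ring)).neg
    rw [one_smul] at h
    rw [mul_add, mul_one]
    simpa only [neg_smul, neg_neg] using h
  have unif : ∀ {C : ℝ} {l : ℕ} (_ : 0 ≤ C) (_ : ∀ (n : ℕ) (t : ℝ), 0 ≤ t →
      |cayleyCoeff l n t| * ((n : ℝ) + 1) ^ k ≤ C * (t + 1) ^ (k + 2) * (1 / (t + 1 + n) ^ 2))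
      (b : ℝ) (n : ℕ) (t : ℝ), 0 ≤ t → t ≤ b → ‖cayleyCoeff l n t • V ^ n‖ ≤
        K * (C * (b + 1) ^ (k + 2)) * (1 / (1 + n) ^ 2) := fun hC h b n t ht htb => by
    refine (term h n t ht).trans ?_
    have hb : 0 ≤ b := ht.trans htb
    gcongr
    linarith
  refine ⟨m, K * C₁ * 2, by positivity, fun t ht => ?_, ?_, fun t ht => (hsucc t ht).tsum_eq,
    fun t ht => ?_⟩
  · have hτ : 0 < t + 1 := by positivity
    have hs := (hsq (by linarith : 1 ≤ t + 1)).mul_left (K * (C₁ * (t + 1) ^ (k + 2)))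
    refine (tsum_of_norm_bounded hs.hasSum fun n => term h₁ n t ht).trans ?_
    rw [tsum_mul_left]
    calc K * (C₁ * (t + 1) ^ (k + 2)) * ∑' n : ℕ, 1 / (t + 1 + n) ^ 2
        ≤ K * (C₁ * (t + 1) ^ (k + 2)) * (2 / (t + 1)) := by
          gcongr
          exact Real.tsum_le_of_sum_range_le (fun n => by positivity)
            (sum_one_div_sq_le (by linarith))
      _ = K * C₁ * 2 * (t + 1) ^ (k + 1) := by
          rw [show k + 2 = k + 1 + 1 by ring, Real.rpow_add_one hτ.ne']
          field_simp
  · intro t ht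
    have hc : ContinuousOn (cayleySum V (m + 1)) (Set.Icc 0 (t + 1)) :=
      continuousOn_tsum (fun n => Continuous.continuousOn (Continuous.smul
        (continuous_iff_continuousAt.2 fun s => (hasDerivAt_cayleyCoeff _ _ s).continuousAt)
        continuous_const)) ((hsq le_rfl).mul_left _)
        fun n s hs => unif hC₁ h₁ (t + 1) n s hs.1 hs.2
    refine (hc t ⟨ht, by linarith⟩).mono_of_mem_nhdsWithin ?_
    rw [← Set.Ici_inter_Iic]
    exact inter_mem self_mem_nhdsWithin (mem_nhdsWithin_of_mem_nhds (Iic_mem_nhds (by linarith)))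
  · rw [← (hder t ht.le).tsum_eq]
    have hu := (hsq le_rfl).mul_left (K * (C₀ * (t + 1 + 1) ^ (k + 2)))
    -- The derivative coefficient at `n` involves level-`m` coefficients at `n` and `n-1`; the
    -- shifted term costs a factor `‖V‖`.
    have hu' : Summable fun n : ℕ => K * (C₀ * (t + 1 + 1) ^ (k + 2)) * (1 / (1 + n) ^ 2) +
        ‖V‖ * (if n = 0 then 0 else
          K * (C₀ * (t + 1 + 1) ^ (k + 2)) * (1 / (1 + (n - 1 : ℕ)) ^ 2)) := by
      refine hu.add (Summable.mul_left _ ?_)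
      rw [← summable_nat_add_iff 1]
      simpa using hu
    refine hasDerivAt_tsum_of_isPreconnected hu' isOpen_Ioo (isPreconnected_Ioo (a := 0)
      (b := t + 1)) (fun n s _ => (hasDerivAt_cayleyCoeff (m + 1) n s).smul_const (V ^ n))
      (fun n s hs => ?_) ⟨ht, by linarith⟩ (hsucc t ht.le).summable ⟨ht, by linarith⟩
    have key := fun n => unif hC₀ h₀ (t + 1) n s hs.1.le hs.2.le
    cases n with
    | zero =>
      simpa [cayleyCoeffDeriv_col_zero, cayleyCoeff_col_zero] using key 0
    | succ n =>
      rw [cayleyCoeffDeriv_succ_succ, cayleyCoeffDeriv_sub, neg_smul, norm_neg, add_smul]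
      refine (norm_add_le _ _).trans (add_le_add (key _) ?_)
      rw [pow_succ', ← mul_smul_comm]
      refine (norm_mul_le _ _).trans (mul_le_mul_of_nonneg_left ?_ (norm_nonneg _))
      simpa using key n

end BanachAlgebra

/-! ### Semigroup side: orbits, resolvent and smoothing. -/

namespace C0Semigroup

variable {X : Type*} [NormedAddCommGroup X] [NormedSpace ℂ X] (T : C0Semigroup X)

theorem map_nsmul (n : ℕ) (s : ℝ≥0) : T (n • s) = T s ^ n := by
  induction n with
  | zero => rw [zero_smul, pow_zero]; exact T.map_zero'
  | succ n ih => rw [succ_nsmul, pow_succ, ← ih]; exact T.map_add' _ _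

variable {T}

theorem HasGenerator.map {x y : X} (h : T.HasGenerator x y) (s : ℝ≥0) :
    T.HasGenerator (T s x) (T s y) := by
  refine (((T s).continuous.tendsto y).comp h).congr fun t => ?_
  have e : T t (T s x) = T s (T t x) := by
    have h1 : T (t + s) x = T t (T s x) := by rw [T.map_add']; rfl
    have h2 : T (s + t) x = T s (T t x) := by rw [T.map_add']; rfl
    rw [← h1, ← h2, add_comm]
  rw [e, ← map_sub, ← map_smul]
  rfl

theorem HasGenerator.hasDerivWithinAt {x y : X} (h : T.HasGenerator x y) {s : ℝ} (hs : 0 ≤ s) :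
    HasDerivWithinAt (fun r : ℝ => T r.toNNReal x) (T s.toNNReal y) (Set.Ici s) s := by
  rw [hasDerivWithinAt_iff_tendsto_slope]
  have hlim : Tendsto (fun r : ℝ => (r - s).toNNReal) (𝓝[Set.Ici s \ {s}] s) (𝓝[>] 0) := by
    refine tendsto_nhdsWithin_iff.2 ⟨?_, ?_⟩
    · have : Continuous fun r : ℝ => (r - s).toNNReal := by fun_prop
      simpa using (this.tendsto s).mono_left nhdsWithin_le_nhds
    · filter_upwards [self_mem_nhdsWithin] with r hr
      have : s < r := lt_of_le_of_ne hr.1 (Ne.symm hr.2)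
      simpa using this
  refine ((h.map s.toNNReal).comp hlim).congr' ?_
  filter_upwards [self_mem_nhdsWithin] with r hr
  have hr' : s ≤ r := hr.1
  have e : T r.toNNReal x = T (r - s).toNNReal (T s.toNNReal x) := by
    have : r.toNNReal = (r - s).toNNReal + s.toNNReal := by
      rw [← Real.toNNReal_add (by linarith) hs]
      simp
    rw [this, T.map_add']
    rfl
  simp only [Function.comp_apply, slope_def_module]
  rw [e, Real.coe_toNNReal _ (by linarith : 0 ≤ r - s), ← Complex.ofReal_inv, Complex.coe_smul]

theorem exists_norm_le_of_le_one [CompleteSpace X] :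
    ∃ M, ∀ t : ℝ≥0, t ≤ 1 → ‖T t‖ ≤ M := by
  obtain ⟨M, hM⟩ := banach_steinhaus (g := fun t : Set.Icc (0 : ℝ≥0) 1 => T t) fun x => by
    obtain ⟨C, hC⟩ := isCompact_Icc.exists_bound_of_continuousOn
      (T.continuous_orbit' x).continuousOn
    exact ⟨C, fun t => hC t t.2⟩
  exact ⟨M, fun t ht => hM ⟨t, zero_le, ht⟩⟩

end C0Semigroup

theorem openSector_mem_nhds {δ s : ℝ} (hδ : 0 < δ) (hs : 0 < s) :
    openSector δ ∈ 𝓝 (s : ℂ) := by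
  have h1 : ∀ᶠ z : ℂ in 𝓝 (s : ℂ), z ≠ 0 :=
    isOpen_ne.mem_nhds (by simpa using hs.ne')
  have h2 : ∀ᶠ z : ℂ in 𝓝 (s : ℂ), |z.arg| < δ := by
    have := (Complex.continuousAt_arg (x := (s : ℂ)) (by simp [hs])).abs
    refine this.eventually_lt continuousAt_const ?_
    simpa [Complex.arg_ofReal_of_nonneg hs.le] using hδ
  exact h1.and h2

namespace C0Semigroup

variable {X : Type*} [NormedAddCommGroup X] [NormedSpace ℂ X] {T : C0Semigroup X}

/-- `A T(s)` is the operator-norm derivative of the holomorphic extension at `s`, hence bounded. -/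
theorem IsAnalytic.exists_hasGenerator (hT : T.IsAnalytic) {s : ℝ≥0} (hs : 0 < s) :
    ∃ D : X →L[ℂ] X, ∀ x, T.HasGenerator (T s x) (D x) := by
  obtain ⟨δ, hδ, -, S, hS, -, hdiff, -⟩ := hT
  have hs' : (0 : ℝ) < s := hs
  have hd := (hdiff.differentiableAt (openSector_mem_nhds hδ hs')).hasDerivAt
  refine ⟨deriv S ((s : ℝ) : ℂ), fun x => ?_⟩
  have hlim : Tendsto (fun t : ℝ≥0 => ((t : ℝ) : ℂ)) (𝓝[>] 0) (𝓝[≠] 0) := by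
    refine tendsto_nhdsWithin_iff.2 ⟨?_, ?_⟩
    · have : Continuous fun t : ℝ≥0 => ((t : ℝ) : ℂ) := by fun_prop
      simpa using (this.tendsto 0).mono_left nhdsWithin_le_nhds
    · filter_upwards [self_mem_nhdsWithin] with t ht
      simpa using (ne_of_gt ht : t ≠ 0)
  have h := ((ContinuousLinearMap.apply ℂ X x).continuous.tendsto _).comp
    (hd.tendsto_slope_zero.comp hlim)
  refine h.congr fun t => ?_
  have e : S ((s : ℝ) + (t : ℝ) : ℂ) = (T t).comp (T s) := by
    rw [← T.map_add', ← hS, add_comm t s]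
    push_cast
    rfl
  simp [e, hS]

/-- Data extracted from `1 ∈ ρ(A)`: the operator `J = (A - I)⁻¹`. -/
theorem IsCogenerator.exists_resolvent {V : X →L[ℂ] X} (hV : T.IsCogenerator V) :
    ∃ J : X →L[ℂ] X, V = 1 + (2 : ℂ) • J ∧ (∀ x, T.HasGenerator (J x) (x + J x)) ∧
      ∀ x y, T.HasGenerator x y → J (y - x) = x := by
  obtain ⟨J, ⟨h1, h2⟩, h3⟩ := hV
  have hA : ∀ x (h : J x ∈ T.generator.domain), T.generator ⟨J x, h⟩ = x + J x := fun x h => by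
    obtain ⟨_, h'⟩ := h1 x
    rw [one_smul] at h'
    exact eq_add_of_sub_eq h'
  refine ⟨J, ?_, fun x => ?_, fun x y hxy => ?_⟩
  · ext x
    obtain ⟨h, h'⟩ := h3 x
    rw [h', hA]
    simp only [add_apply, one_apply_eq_self, two_smul]
    abel
  · obtain ⟨h, -⟩ := h1 x
    rw [← hA x h]
    exact T.hasGenerator_generator ⟨J x, h⟩
  · have h := h2 ⟨x, y, hxy⟩
    rwa [(T.hasGenerator_generator ⟨x, y, hxy⟩).unique hxy, one_smul] at h

theorem apply_comm_resolvent {J : X →L[ℂ] X} (h1 : ∀ x, T.HasGenerator (J x) (x + J x))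
    (h2 : ∀ x y, T.HasGenerator x y → J (y - x) = x) (t : ℝ≥0) (x : X) :
    T t (J x) = J (T t x) := by
  have := h2 _ _ ((h1 x).map t)
  rw [← this, ← map_sub, add_sub_cancel_right]

/-- An analytic semigroup maps `X` into the domain of every power of its generator. -/
theorem IsAnalytic.exists_eq_pow_mul (hT : T.IsAnalytic) {J : X →L[ℂ] X}
    (h1 : ∀ x, T.HasGenerator (J x) (x + J x))
    (h2 : ∀ x y, T.HasGenerator x y → J (y - x) = x) (p : ℕ) :
    ∃ B : X →L[ℂ] X, T 1 = J ^ (p + 1) * B := by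
  -- `T(1) = T(s)^(p+1)`, and each factor `T(s) = J(D - T(s))` supplies one `J`.
  set s : ℝ≥0 := ((p + 1 : ℕ) : ℝ≥0)⁻¹ with hs
  obtain ⟨D, hD⟩ := hT.exists_hasGenerator (s := s) (by positivity)
  have hB : ∀ x, J ((D - T s) x) = T s x := fun x => h2 _ _ (hD x)
  have hinj : Function.Injective J := by
    rw [injective_iff_map_eq_zero]
    intro x hx
    have h3 := h1 x
    have h0 : T.HasGenerator 0 0 := by simp [HasGenerator]
    rw [hx, add_zero] at h3
    exact h3.unique h0
  have hcomm : Commute J (D - T s) := by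
    ext x
    apply hinj
    change J (J ((D - T s) x)) = J ((D - T s) (J x))
    rw [hB, hB, apply_comm_resolvent h1 h2]
  refine ⟨(D - T s) ^ (p + 1), ?_⟩
  have e : T s = J * (D - T s) := by
    ext x
    exact (hB x).symm
  rw [← hcomm.mul_pow, ← e, ← map_nsmul, hs, nsmul_eq_mul, mul_inv_cancel₀ (by positivity)]

/-- `F(t) J = (I - V) ^ (m + 1) T(t) J`, where `F(t)` is the power series in `V`. -/
theorem cayleySum_apply_resolvent {V J : X →L[ℂ] X} (hVJ : V = 1 + (2 : ℂ) • J)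
    (h1 : ∀ x, T.HasGenerator (J x) (x + J x))
    (h2 : ∀ x y, T.HasGenerator x y → J (y - x) = x) {m : ℕ}
    (hcont : ContinuousOn (cayleySum V (m + 1)) (Set.Ici 0))
    (hsucc : ∀ t, 0 ≤ t → cayleySum V (m + 1) t = cayleySum V m t * (1 - V))
    (hder : ∀ t, 0 < t →
      HasDerivAt (cayleySum V (m + 1)) (-(cayleySum V m t * (1 + V))) t)
    (t : ℝ≥0) (x : X) :
    cayleySum V (m + 1) t (J x) = ((1 - V) ^ (m + 1)) (T t (J x)) := by
  have hb := isBoundedBilinearMap_apply (𝕜 := ℂ) (E := X) (F := X)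
  -- `f` interpolates between the two sides (`s = 0` and `s = t`). Its right derivative vanishes
  -- because `(1+V)J + (1-V)(1+J) = 0`.
  set f : ℝ → X := fun s => cayleySum V (m + 1) (t - s) (T s.toNNReal (J x)) with hf
  have hfc : ContinuousOn f (Set.Icc 0 t) := by
    refine hb.continuous.comp_continuousOn (ContinuousOn.prodMk ?_ ?_)
    · exact hcont.comp (by fun_prop) fun s hs => sub_nonneg.2 hs.2
    · exact ((T.continuous_orbit' (J x)).comp continuous_real_toNNReal).continuousOn
  have hfd : ∀ s ∈ Set.Ico (0 : ℝ) t, HasDerivWithinAt f 0 (Set.Ici s) s := fun s hs => by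
    have hW : HasDerivWithinAt (fun s : ℝ => cayleySum V (m + 1) (t - s))
        (cayleySum V m (t - s) * (1 + V)) (Set.Ici s) s := by
      have := (hder (t - s) (sub_pos.2 hs.2)).scomp s ((hasDerivAt_id s).const_sub (t : ℝ))
      simpa [Function.comp_def] using this.hasDerivWithinAt
    have hT := (h1 x).hasDerivWithinAt hs.1
    have := ((hb.hasFDerivAt (cayleySum V (m + 1) (t - s),
      T s.toNNReal (J x))).restrictScalars ℝ).comp_hasDerivWithinAt s (hW.prodMk hT)
    refine this.congr_deriv ?_
    simp only [ContinuousLinearMap.coe_restrictScalars', IsBoundedBilinearMap.deriv_apply]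
    rw [hsucc _ (sub_nonneg.2 hs.2.le), map_add, apply_comm_resolvent h1 h2]
    set y := T s.toNNReal x
    simp only [mul_apply_eq_comp]
    rw [← map_add]
    convert map_zero (cayleySum V m (t - s))
    simp [hVJ, two_smul]
    abel
  have h := constant_of_has_deriv_right_zero hfc hfd t ⟨t.2, le_rfl⟩
  simp only [hf, sub_self, sub_zero, Real.toNNReal_coe, Real.toNNReal_zero, cayleySum_zero] at h
  rw [h, T.map_zero']
  rfl

end C0Semigroup

/-! ### The growth bound. -/

theorem theorem5p3 {X : Type*} [NormedAddCommGroup X] [NormedSpace ℂ X] [CompleteSpace X]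
    (T : C0Semigroup X) (hT : T.IsAnalytic)
    (V : X →L[ℂ] X) (hV : T.IsCogenerator V)
    (C k : ℝ) (hC : 0 ≤ C) (hk : 0 ≤ k)
    (hVn : ∀ n : ℕ, 1 ≤ n → ‖V ^ n‖ ≤ C * (n : ℝ) ^ k) :
    ∃ M : ℝ, ∀ t : ℝ≥0, ‖T t‖ ≤ M * (1 + (t : ℝ) ^ (2 * k + 1)) := by
  obtain ⟨J, hVJ, h1, h2⟩ := hV.exists_resolvent
  have hVn' : ∀ n : ℕ, ‖V ^ n‖ ≤ (C + 1) * ((n : ℝ) + 1) ^ k := fun n => by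
    rcases Nat.eq_zero_or_pos n with rfl | hn
    · have : ‖(1 : X →L[ℂ] X)‖ ≤ 1 := ContinuousLinearMap.norm_id_le
      simp only [pow_zero, Nat.cast_zero, zero_add, Real.one_rpow, mul_one]
      linarith
    · refine (hVn n hn).trans ?_
      gcongr <;> linarith
  obtain ⟨m, M, hM, hnorm, hcont, hsucc, hder⟩ :=
    exists_cayleySum_spec (by positivity) hk hVn'
  -- `m+1` factors `J` absorb `(1-V)^(m+1)`; one more puts the vector in `D(A)`.
  obtain ⟨B, hB⟩ := hT.exists_eq_pow_mul h1 h2 (m + 1)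
  obtain ⟨M₁, hM₁⟩ := C0Semigroup.exists_norm_le_of_le_one (T := T)
  have hM₁0 : 0 ≤ M₁ := (norm_nonneg _).trans (hM₁ 0 zero_le_one)
  have hpow : (1 - V) ^ (m + 1) = ((-2 : ℂ) ^ (m + 1)) • J ^ (m + 1) := by
    rw [← smul_pow, hVJ]
    congr 1
    rw [neg_smul]
    abel
  have hJT : ∀ (t : ℝ≥0) (x : X), T t ((J ^ (m + 1 + 1)) x) =
      ((-2 : ℂ) ^ (m + 1))⁻¹ • cayleySum V (m + 1) t (J x) := fun t x => by
    have hc : Commute (T t) J := by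
      ext y
      exact C0Semigroup.apply_comm_resolvent h1 h2 t y
    have e := congrArg (fun L : X →L[ℂ] X => L (J x)) (hc.pow_right (m + 1)).eq
    simp only [mul_apply_eq_comp] at e
    rw [C0Semigroup.cayleySum_apply_resolvent hVJ h1 h2 hcont hsucc hder, hpow, pow_succ,
      mul_apply_eq_comp, e, FunLike.coe_smul, Pi.smul_apply, smul_smul,
      inv_mul_cancel₀ (by simp), one_smul]
  have hlarge : ∀ t : ℝ≥0, ‖T (t + 1)‖ ≤ M * ‖J‖ * ‖B‖ * ((t : ℝ) + 1) ^ (k + 1) := fun t => by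
    refine ContinuousLinearMap.opNorm_le_bound _ (by positivity) fun x => ?_
    have hinv : ‖((-2 : ℂ) ^ (m + 1))⁻¹‖ ≤ 1 := by
      rw [norm_inv, norm_pow]
      refine inv_le_one_of_one_le₀ (one_le_pow₀ ?_)
      norm_num
    rw [T.map_add', hB, ContinuousLinearMap.comp_apply, mul_apply_eq_comp, hJT,
      norm_smul]
    calc _ ≤ 1 * (M * ((t : ℝ) + 1) ^ (k + 1) * (‖J‖ * (‖B‖ * ‖x‖))) := by
          refine mul_le_mul hinv ?_ (norm_nonneg _) zero_le_one
          refine (ContinuousLinearMap.le_opNorm _ _).trans ?_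
          refine mul_le_mul (hnorm t t.2) ?_ (norm_nonneg _) (by positivity)
          exact (J.le_opNorm _).trans (mul_le_mul_of_nonneg_left (B.le_opNorm x) (norm_nonneg _))
      _ = _ := by ring
  refine ⟨M₁ + M * ‖J‖ * ‖B‖, fun t => ?_⟩
  have hN : 0 ≤ M * ‖J‖ * ‖B‖ := by positivity
  have ht0 : 0 ≤ (t : ℝ) ^ (2 * k + 1) := by positivity
  rcases le_total t 1 with ht | ht
  · nlinarith [hM₁ t ht, mul_nonneg hM₁0 ht0, mul_nonneg hN ht0]
  · have e : t - 1 + 1 = t := tsub_add_cancel_of_le ht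
    have h := hlarge (t - 1)
    rw [e, show ((t - 1 : ℝ≥0) : ℝ) + 1 = t by exact_mod_cast congrArg NNReal.toReal e] at h
    have hle : (t : ℝ) ^ (k + 1) ≤ (t : ℝ) ^ (2 * k + 1) :=
      Real.rpow_le_rpow_of_exponent_le (by exact_mod_cast ht) (by linarith)
    nlinarith [mul_le_mul_of_nonneg_left hle hN, mul_nonneg hM₁0 ht0]
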